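/- Throughout, $A$ is a partially ordered set with a top element $\top$ and a bottom element $\bot$. The games over $A$ are defined inductively: every $a\in A$ gives an atomic game $[a]$ (with no options), and if $L,R$ are non-empty sets of games, then $\{L\,|\,R\}$ is a (composite) game with left options $L$ and right options $R$. We write $\top,\bot$ also for the games $[\top],[\bot]$. Relations $\le$ and $\lhd$ on games are defined by mutual recursion: - $G\le H$ iff every left option $G^L$ of $G$ satisfies $G^L\lhd H$, every right option $H^R$ of $H$ satisfies $G\lhd H^R$, and, if $G$ or $H$ is atomic, $G\lhd H$; - $G\lhd H$ iff some right option $G^R$ of $G$ satisfies $G^R\le H$, or some left option $H^L$ of $H$ satisfies $G\le H^L$, or $G=[a]$ and $H=[b]$ are atomic with $a\le b$. Games $G,H$ are equivalent if $G\le H$ and $H\le G$. A monotone set coloring game $S$ over $A$ consists of a finite set $|S|$ of cells (the carrier) and a monotone payoff function $\pi_S:\{\bot,\top\}^{|S|}\to A$ (pointwise order, $\bot<\top$). A position is a map $p:|S|\to\{\top,\bot,\star\}$, where $\star$ marks an empty cell. It determines a game $[\![p]\!]$ over $A$: if no cell is empty, $[\![p]\!]=[\pi_S(p)]$; otherwise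 the left (respectively right) options of $[\![p]\!]$ are the games $[\![p']\!]$, where $p'$ is obtained from $p$ by coloring exactly one empty cell with $\top$ (respectively $\bot$). The game of $S$ is $[\![p_0]\!]$ for the position $p_0$ in which all cells are empty. A game $G$ over $A$ is realizable with size $n$ if $G$ is equivalent to the game of some monotone set coloring game over $A$ whose carrier has exactly $n$ elements. **Proposition 4.1.** Let $G$ and $H$ be games over $A$ that are realizable with size $p$ and $q$, respectively. Then (a) $\{\top\,|\,G\}$ and $\{G\,|\,\bot\}$ are each realizable with size $p+1$; (b) the choice gadget $\{\{\top|G\},\{\top|H\}\,|\,\{G|\bot\},\{H|\bot\}\}$ is realizable with size $\max\{p,q\}+2$; (c) the coupling gadget $\{G,\{\top|H\}\,|\,\{G|\bot\},H\}$ is realizable with size $p+q+5$. -/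

import Mathlib

universe u v

/-- Combinatorial games over a set `A` of atoms. A game is either an atomic game `[a]` or a
composite game `{L | R}` with non-empty collections `L`, `R` of left and right options. As usual
for combinatorial games in type theory, the collections of options are (small) indexed families;
order and equivalence below depend only on the sets of options. -/
inductive PosetGame (A : Type u) : Type (max u (v + 1))
  | atom (a : A) : PosetGame A
  | comp (ι κ : Type v) [Nonempty ι] [Nonempty κ]
      (L : ι → PosetGame A) (R : κ → PosetGame A) : PosetGame A

namespace PosetGame

/-- The set of left options; atomic games have none. -/
def leftOptions {A : Type u} : PosetGame.{u, v} A → Set (PosetGame.{u, v} A)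
  | atom _ => ∅
  | comp _ _ L _ => Set.range L

/-- The set of right options; atomic games have none. -/
def rightOptions {A : Type u} : PosetGame.{u, v} A → Set (PosetGame.{u, v} A)
  | atom _ => ∅
  | comp _ _ _ R => Set.range R

/-- The game is of the form `[a]`. -/
def IsAtomic {A : Type u} (G : PosetGame.{u, v} A) : Prop := ∃ a : A, G = atom a

mutual

/-- The order `G ≤ H` on games (simultaneously with `Tri`). The defining clauses decrease along
options, so that the least relations closed under them are the ones defined by recursion; see
`le_iff` and `tri_iff`. -/
inductive Le {A : Type u} [PartialOrder A] : PosetGame.{u, v} A → PosetGame.{u, v} A → Prop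
  | intro {G H : PosetGame.{u, v} A}
      (left : ∀ G' ∈ G.leftOptions, Tri G' H)
      (right : ∀ H' ∈ H.rightOptions, Tri G H')
      (atomic : G.IsAtomic ∨ H.IsAtomic → Tri G H) : Le G H

/-- The relation `G ⊲ H` on games (simultaneously with `Le`). -/
inductive Tri {A : Type u} [PartialOrder A] : PosetGame.{u, v} A → PosetGame.{u, v} A → Prop
  | right {G H G' : PosetGame.{u, v} A} (mem : G' ∈ G.rightOptions) (le : Le G' H) : Tri G H
  | left {G H H' : PosetGame.{u, v} A} (mem : H' ∈ H.leftOptions) (le : Le G H') : Tri G H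
  | atom {a b : A} (le : a ≤ b) : Tri (PosetGame.atom a) (PosetGame.atom b)

end

theorem le_iff {A : Type u} [PartialOrder A] {G H : PosetGame.{u, v} A} :
    Le G H ↔ (∀ G' ∈ G.leftOptions, Tri G' H) ∧ (∀ H' ∈ H.rightOptions, Tri G H') ∧
      (G.IsAtomic ∨ H.IsAtomic → Tri G H) :=
  ⟨fun h => by cases h with | intro h₁ h₂ h₃ => exact ⟨h₁, h₂, h₃⟩,
    fun h => Le.intro h.1 h.2.1 h.2.2⟩

theorem tri_iff {A : Type u} [PartialOrder A] {G H : PosetGame.{u, v} A} :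
    Tri G H ↔ (∃ G' ∈ G.rightOptions, Le G' H) ∨ (∃ H' ∈ H.leftOptions, Le G H') ∨
      (∃ a b : A, G = PosetGame.atom a ∧ H = PosetGame.atom b ∧ a ≤ b) := by
  constructor
  · intro h
    cases h with
    | right m h => exact Or.inl ⟨_, m, h⟩
    | left m h => exact Or.inr (Or.inl ⟨_, m, h⟩)
    | atom h => exact Or.inr (Or.inr ⟨_, _, rfl, rfl, h⟩)
  · rintro (⟨_, m, h⟩ | ⟨_, m, h⟩ | ⟨a, b, rfl, rfl, h⟩)
    · exact Tri.right m h
    · exact Tri.left m h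
    · exact Tri.atom h

/-- Equivalence of games: `G ≤ H` and `H ≤ G`. -/
def Equivalent {A : Type u} [PartialOrder A] (G H : PosetGame.{u, v} A) : Prop :=
  Le G H ∧ Le H G

/-- The game `{G | H}` with one left and one right option. -/
def single {A : Type u} (G H : PosetGame.{u, v} A) : PosetGame.{u, v} A :=
  comp PUnit PUnit (fun _ => G) (fun _ => H)

/-- The game `{G₁, G₂ | H₁, H₂}`. -/
def pair {A : Type u} (G₁ G₂ H₁ H₂ : PosetGame.{u, v} A) : PosetGame.{u, v} A :=
  comp (ULift Bool) (ULift Bool)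
    (fun i => if i.down then G₂ else G₁) (fun i => if i.down then H₂ else H₁)

theorem leftOptions_single {A : Type u} (G H : PosetGame.{u, v} A) :
    (single G H).leftOptions = {G} := by
  simp [single, leftOptions]

theorem rightOptions_single {A : Type u} (G H : PosetGame.{u, v} A) :
    (single G H).rightOptions = {H} := by
  simp [single, rightOptions]

theorem leftOptions_pair {A : Type u} (G₁ G₂ H₁ H₂ : PosetGame.{u, v} A) :
    (pair G₁ G₂ H₁ H₂).leftOptions = {G₁, G₂} := by
  ext x
  constructor
  · rintro ⟨⟨i⟩, rfl⟩
    cases i <;> simp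
  · rintro (rfl | rfl)
    · exact ⟨⟨false⟩, by simp⟩
    · exact ⟨⟨true⟩, by simp⟩

theorem rightOptions_pair {A : Type u} (G₁ G₂ H₁ H₂ : PosetGame.{u, v} A) :
    (pair G₁ G₂ H₁ H₂).rightOptions = {H₁, H₂} := by
  ext x
  constructor
  · rintro ⟨⟨i⟩, rfl⟩
    cases i <;> simp
  · rintro (rfl | rfl)
    · exact ⟨⟨false⟩, by simp⟩
    · exact ⟨⟨true⟩, by simp⟩

/-- Left forcing gadget `{⊤ | G}`. -/
def leftForcing {A : Type u} [PartialOrder A] [BoundedOrder A] (G : PosetGame.{u, v} A) :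
    PosetGame.{u, v} A :=
  single (atom ⊤) G

/-- Right forcing gadget `{G | ⊥}`. -/
def rightForcing {A : Type u} [PartialOrder A] [BoundedOrder A] (G : PosetGame.{u, v} A) :
    PosetGame.{u, v} A :=
  single G (atom ⊥)

/-- Choice gadget `{{⊤ | G}, {⊤ | H} | {G | ⊥}, {H | ⊥}}`. -/
def choiceGadget {A : Type u} [PartialOrder A] [BoundedOrder A] (G H : PosetGame.{u, v} A) :
    PosetGame.{u, v} A :=
  pair (leftForcing G) (leftForcing H) (rightForcing G) (rightForcing H)

/-- Coupling gadget `{G, {⊤ | H} | {G | ⊥}, H}`. -/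
def couplingGadget {A : Type u} [PartialOrder A] [BoundedOrder A] (G H : PosetGame.{u, v} A) :
    PosetGame.{u, v} A :=
  pair G (leftForcing H) (rightForcing G) H

end PosetGame

/-- A monotone set coloring game over `A`: a finite carrier of cells and a monotone payoff function
from the colorings of the cells by booleans (`true` for Left, `false` for Right, with
`false < true` and the pointwise order) to `A`. -/
structure SetColoringGame (A : Type u) [PartialOrder A] where
  carrier : Type v
  finite_carrier : Finite carrier
  payoff : (carrier → Bool) → A
  monotone_payoff : Monotone payoff

namespace SetColoringGame

/-- The size of a set coloring game: the number of its cells. -/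
noncomputable def size {A : Type u} [PartialOrder A] (S : SetColoringGame.{u, v} A) : ℕ :=
  Nat.card S.carrier

/-- A position: each cell has color `some true` (Left), `some false` (Right) or is empty
(`none`). -/
abbrev Position {A : Type u} [PartialOrder A] (S : SetColoringGame.{u, v} A) : Type v :=
  S.carrier → Option Bool

open Classical in
/-- The position obtained from `p` by coloring the cell `c` with the color `b`. -/
noncomputable def color {A : Type u} [PartialOrder A] (S : SetColoringGame.{u, v} A)
    (p : S.Position) (c : S.carrier) (b : Bool) : S.Position :=
  Function.update p c (some b)

theorem ncard_color_lt {A : Type u} [PartialOrder A] (S : SetColoringGame.{u, v} A)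
    (p : S.Position) (c : S.carrier) (hc : p c = none) (b : Bool) :
    {x | S.color p c b x = none}.ncard < {x | p x = none}.ncard := by
  classical
  have := S.finite_carrier
  apply Set.ncard_lt_ncard _ (Set.toFinite _)
  refine ⟨fun x hx => ?_, fun h => ?_⟩
  · by_cases hxc : x = c
    · subst hxc; exact hc
    · simpa [color, hxc] using hx
  · have := h (show c ∈ {x | p x = none} from hc)
    simp [color] at this

open Classical in
/-- The combinatorial game associated with a position `p`. If `p` has an empty cell, its left
(right) options are the games of the positions obtained from `p` by coloring one empty cell with
Left's (Right's) color. Otherwise the game is atomic, given by the payoff of the coloring `p` (the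
default value of `getD` is then never used). -/
noncomputable def sem {A : Type u} [PartialOrder A] (S : SetColoringGame.{u, v} A)
    (p : S.Position) : PosetGame.{u, v} A :=
  if h : Nonempty {c : S.carrier // p c = none} then
    PosetGame.comp {c : S.carrier // p c = none} {c : S.carrier // p c = none}
      (fun c => S.sem (S.color p c.1 true)) (fun c => S.sem (S.color p c.1 false))
  else
    PosetGame.atom (S.payoff fun c => (p c).getD false)
termination_by {c | p c = none}.ncard
decreasing_by
  · exact S.ncard_color_lt p c.1 c.2 true
  · exact S.ncard_color_lt p c.1 c.2 false

/-- The combinatorial game of `S`: that of its all-empty initial position. -/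
noncomputable def value {A : Type u} [PartialOrder A] (S : SetColoringGame.{u, v} A) :
    PosetGame.{u, v} A :=
  S.sem fun _ => none

end SetColoringGame

/-- `G` is realizable with size `n`: it is equivalent to the game of some monotone set coloring
game with exactly `n` cells. -/
def PosetGame.RealizableWithSize {A : Type u} [PartialOrder A] (G : PosetGame.{u, v} A)
    (n : ℕ) : Prop :=
  ∃ S : SetColoringGame.{u, v} A, S.size = n ∧ G.Equivalent S.value

-- The preorder on games

namespace PosetGame

variable {A : Type u}

-- Let `S` and `T` realize `G` and `H`. Each gadget is realized by adding control cells (one for a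
-- forcing gadget, two for choice, five for coupling) to a board carrying `S` and `T`. The final
-- colors of the control cells decide whether the payoff is `⊤`, `⊥`, that of `S` or that of `T`
-- (`control`). What has to be shown is that moves outside the control cells, made before the
-- selection is settled, do not disturb the comparison with the gadget.
--
-- Set coloring games have no zugzwang: an extra move never hurts, so `Tri` holds wherever the
-- cellwise comparison gives `Le` (`sem_le_sem_aux`). Hence cells that do not affect the payoff are
-- harmless, and `S` and `T` can be put on a common board. The gadgets share this property
-- (`Stable`): an early move on the board can be answered inside the gadget. So the comparison
-- reduces, by induction on the number of empty board cells, to play in the control cells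
-- (`control_sem_leOn_of_step`).
--
-- That remaining comparison no longer depends on `G` and `H`. It is a finite search (`Plan.sim`),
-- sound by `control_sem_of_sim` and evaluated by the kernel. Stability of choice holds however the
-- two boards overlap, which gives `max p q`; stability of coupling needs every cell to be dead in
-- one of the two games, which gives `p + q`.

theorem options_induction {P : PosetGame.{u, v} A → Prop}
    (h : ∀ G : PosetGame.{u, v} A, (∀ G' ∈ G.leftOptions, P G') →
      (∀ G' ∈ G.rightOptions, P G') → P G) (G : PosetGame.{u, v} A) : P G := by
  induction G with
  | atom a => exact h _ (by simp [leftOptions]) (by simp [rightOptions])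
  | comp ι κ L R hL hR =>
    refine h _ ?_ ?_
    · rintro _ ⟨i, rfl⟩
      exact hL i
    · rintro _ ⟨i, rfl⟩
      exact hR i

theorem not_isAtomic_pair (G₁ G₂ H₁ H₂ : PosetGame.{u, v} A) :
    ¬ (pair G₁ G₂ H₁ H₂).IsAtomic := by
  rintro ⟨a, h⟩
  cases h

theorem not_isAtomic_single (G H : PosetGame.{u, v} A) : ¬ (single G H).IsAtomic := by
  rintro ⟨a, h⟩
  cases h

variable [PartialOrder A]

theorem Le.refl (G : PosetGame.{u, v} A) : Le G G := by
  induction G using options_induction with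
  | h G hL hR =>
    refine Le.intro (fun G' m => Tri.left m (hL _ m)) (fun G' m => Tri.right m (hR _ m)) ?_
    rintro (⟨a, rfl⟩ | ⟨a, rfl⟩) <;> exact Tri.atom le_rfl

theorem Le.tri_left {G H G' : PosetGame.{u, v} A} (h : Le G H) (m : G' ∈ G.leftOptions) :
    Tri G' H := (le_iff.1 h).1 _ m

theorem Le.tri_right {G H H' : PosetGame.{u, v} A} (h : Le G H) (m : H' ∈ H.rightOptions) :
    Tri G H' := (le_iff.1 h).2.1 _ m

theorem Le.tri_of_atomic {G H : PosetGame.{u, v} A} (h : Le G H)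
    (a : G.IsAtomic ∨ H.IsAtomic) : Tri G H := (le_iff.1 h).2.2 a

theorem le_atom {a b : A} (h : a ≤ b) : Le (atom a : PosetGame.{u, v} A) (atom b) :=
  Le.intro (by simp [leftOptions]) (by simp [rightOptions]) fun _ => Tri.atom h

/-- The three forms of transitivity feed each other: each passes to an option of one of the three
games and invokes another form there, so they are proved in one induction. Atoms need the third
clause of `Le`, which supplies the `Tri` to compose with. -/
theorem trans_aux (G H K : PosetGame.{u, v} A) :
    (Tri G H → Le H K → Tri G K) ∧ (Le G H → Tri H K → Tri G K) ∧
      (Le G H → Le H K → Le G K) := by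
  induction G using options_induction generalizing H K with
  | h G gL gR =>
  induction H using options_induction generalizing K with
  | h H HL HR =>
  induction K using options_induction with
  | h K KL KR =>
  have h₁ : Tri G H → Le H K → Tri G K := by
    intro t l
    rcases tri_iff.1 t with ⟨G', m, h⟩ | ⟨H', m, h⟩ | ⟨a, b, rfl, rfl, h⟩
    · exact Tri.right m ((gR _ m H K).2.2 h l)
    · exact (HL _ m K).2.1 h (l.tri_left m)
    · rcases tri_iff.1 (l.tri_of_atomic (Or.inl ⟨_, rfl⟩)) with
        ⟨_, m, _⟩ | ⟨K', m, h'⟩ | ⟨_, c, e, rfl, h'⟩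
      · simp [rightOptions] at m
      · exact Tri.left m ((KL _ m).2.2 (le_atom h) h')
      · cases e
        exact Tri.atom (h.trans h')
  have h₂ : Le G H → Tri H K → Tri G K := by
    intro l t
    rcases tri_iff.1 t with ⟨H', m, h⟩ | ⟨K', m, h⟩ | ⟨a, b, rfl, rfl, h⟩
    · exact (HR _ m K).1 (l.tri_right m) h
    · exact Tri.left m ((KL _ m).2.2 l h)
    · rcases tri_iff.1 (l.tri_of_atomic (Or.inr ⟨_, rfl⟩)) with
        ⟨G', m, h'⟩ | ⟨_, m, _⟩ | ⟨c, _, rfl, e, h'⟩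
      · exact Tri.right m ((gR _ m _ _).2.2 h' (le_atom h))
      · simp [leftOptions] at m
      · cases e
        exact Tri.atom (h'.trans h)
  refine ⟨h₁, h₂, fun l l' => Le.intro (fun G' m => (gL _ m _ _).1 (l.tri_left m) l')
    (fun K' m => (KR _ m).2.1 l (l'.tri_right m)) ?_⟩
  rintro (a | a)
  · exact h₁ (l.tri_of_atomic (Or.inl a)) l'
  · exact h₂ l (l'.tri_of_atomic (Or.inr a))

theorem Le.trans {G H K : PosetGame.{u, v} A} (h : Le G H) (h' : Le H K) : Le G K :=
  (trans_aux G H K).2.2 h h'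

theorem Le.trans_tri {G H K : PosetGame.{u, v} A} (h : Le G H) (h' : Tri H K) : Tri G K :=
  (trans_aux G H K).2.1 h h'

theorem Tri.trans_le {G H K : PosetGame.{u, v} A} (h : Tri G H) (h' : Le H K) : Tri G K :=
  (trans_aux G H K).1 h h'

theorem Equivalent.symm {G H : PosetGame.{u, v} A} (h : G.Equivalent H) : H.Equivalent G :=
  ⟨h.2, h.1⟩

theorem Equivalent.trans {G H K : PosetGame.{u, v} A} (h : G.Equivalent H)
    (h' : H.Equivalent K) : G.Equivalent K :=
  ⟨h.1.trans h'.1, h'.2.trans h.2⟩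

theorem pair_le_pair {G₁ G₂ H₁ H₂ G₁' G₂' H₁' H₂' : PosetGame.{u, v} A}
    (h₁ : Le G₁ G₁') (h₂ : Le G₂ G₂') (h₃ : Le H₁ H₁') (h₄ : Le H₂ H₂') :
    Le (pair G₁ G₂ H₁ H₂) (pair G₁' G₂' H₁' H₂') := by
  refine Le.intro (fun G' m => ?_) (fun H' m => ?_) ?_
  · rw [leftOptions_pair] at m
    rcases m with rfl | rfl
    · exact Tri.left (by simp [leftOptions_pair]) h₁
    · exact Tri.left (H' := G₂') (by simp [leftOptions_pair]) h₂
  · rw [rightOptions_pair] at m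
    rcases m with rfl | rfl
    · exact Tri.right (by simp [rightOptions_pair]) h₃
    · exact Tri.right (G' := H₂) (by simp [rightOptions_pair]) h₄
  · rintro (h | h)
    · exact absurd h (not_isAtomic_pair _ _ _ _)
    · exact absurd h (not_isAtomic_pair _ _ _ _)

theorem pair_equivalent_pair {G₁ G₂ H₁ H₂ G₁' G₂' H₁' H₂' : PosetGame.{u, v} A}
    (h₁ : G₁.Equivalent G₁') (h₂ : G₂.Equivalent G₂') (h₃ : H₁.Equivalent H₁')
    (h₄ : H₂.Equivalent H₂') : (pair G₁ G₂ H₁ H₂).Equivalent (pair G₁' G₂' H₁' H₂') :=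
  ⟨pair_le_pair h₁.1 h₂.1 h₃.1 h₄.1, pair_le_pair h₁.2 h₂.2 h₃.2 h₄.2⟩

/-- Schematic games have exactly two options per player, so forcing gadgets enter them with each
option doubled. -/
theorem single_equivalent_pair {G H G' H' : PosetGame.{u, v} A}
    (h : G.Equivalent G') (h' : H.Equivalent H') :
    (single G H).Equivalent (pair G' G' H' H') := by
  constructor
  · refine Le.intro (fun K m => ?_) (fun K m => ?_) ?_
    · obtain rfl : K = G := by simpa [leftOptions_single] using m
      exact Tri.left (H' := G') (by simp [leftOptions_pair]) h.1
    · obtain rfl : K = H' := by simpa [rightOptions_pair] using m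
      exact Tri.right (G' := H) (by simp [rightOptions_single]) h'.1
    · rintro (h | h)
      · exact absurd h (not_isAtomic_single _ _)
      · exact absurd h (not_isAtomic_pair _ _ _ _)
  · refine Le.intro (fun K m => ?_) (fun K m => ?_) ?_
    · obtain rfl : K = G' := by simpa [leftOptions_pair] using m
      exact Tri.left (H' := G) (by simp [leftOptions_single]) h.2
    · obtain rfl : K = H := by simpa [rightOptions_single] using m
      exact Tri.right (G' := H') (by simp [rightOptions_pair]) h'.2
    · rintro (h | h)
      · exact absurd h (not_isAtomic_pair _ _ _ _)
      · exact absurd h (not_isAtomic_single _ _)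

section Bounded

variable [BoundedOrder A]

/-- For a composite game, `Tri` needs a right option to move to; this is where options being
non-empty is used. -/
theorem le_top_aux (G : PosetGame.{u, v} A) : Le G (atom ⊤) ∧ Tri G (atom ⊤) := by
  induction G using options_induction with
  | h G hL hR =>
    have t : Tri G (atom ⊤) := by
      cases G with
      | atom a => exact Tri.atom le_top
      | comp ι κ L R =>
        obtain ⟨k⟩ := ‹Nonempty κ›
        exact Tri.right ⟨k, rfl⟩ (hR _ ⟨k, rfl⟩).1
    exact ⟨Le.intro (fun G' m => (hL _ m).2) (by simp [rightOptions]) fun _ => t, t⟩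

theorem bot_le_aux (G : PosetGame.{u, v} A) : Le (atom ⊥) G ∧ Tri (atom ⊥) G := by
  induction G using options_induction with
  | h G hL hR =>
    have t : Tri (atom ⊥) G := by
      cases G with
      | atom a => exact Tri.atom bot_le
      | comp ι κ L R =>
        obtain ⟨k⟩ := ‹Nonempty ι›
        exact Tri.left ⟨k, rfl⟩ (hL _ ⟨k, rfl⟩).1
    exact ⟨Le.intro (by simp [leftOptions]) (fun G' m => (hR _ m).2) fun _ => t, t⟩

theorem le_atom_top (G : PosetGame.{u, v} A) : Le G (atom ⊤) := (le_top_aux G).1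

theorem atom_bot_le (G : PosetGame.{u, v} A) : Le (atom ⊥) G := (bot_le_aux G).1

end Bounded

end PosetGame

-- Positions, absence of zugzwang, and dead cells

namespace SetColoringGame

/-- Color the cell `c` of a partial coloring with `b`. -/
noncomputable def paint {α : Type v} (p : α → Option Bool) (c : α) (b : Bool) : α → Option Bool :=
  open Classical in Function.update p c (some b)

@[simp] theorem paint_self {α : Type v} (p : α → Option Bool) (c : α) (b : Bool) :
    paint p c b c = some b := by
  simp [paint]

theorem paint_of_ne {α : Type v} (p : α → Option Bool) {c d : α} (b : Bool) (h : d ≠ c) :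
    paint p c b d = p d := by
  simp [paint, h]

theorem ncard_paint_lt {α : Type v} [Finite α] (p : α → Option Bool) (c : α) (hc : p c = none)
    (b : Bool) : {x | paint p c b x = none}.ncard < {x | p x = none}.ncard := by
  apply Set.ncard_lt_ncard _ (Set.toFinite _)
  refine ⟨fun x hx => ?_, fun h => ?_⟩
  · by_cases hxc : x = c
    · subst hxc; exact hc
    · simpa [paint_of_ne p b hxc] using hx
  · have := h (show c ∈ {x | p x = none} from hc)
    simp at this

variable {A : Type u} [PartialOrder A] (S : SetColoringGame.{u, v} A)

theorem mem_leftOptions_sem {p : S.Position} {G : PosetGame.{u, v} A} :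
    G ∈ (S.sem p).leftOptions ↔ ∃ c, p c = none ∧ G = S.sem (paint p c true) := by
  rw [sem]
  split_ifs with h
  · constructor
    · rintro ⟨c, rfl⟩
      exact ⟨c.1, c.2, rfl⟩
    · rintro ⟨c, hc, rfl⟩
      exact ⟨⟨c, hc⟩, rfl⟩
  · simp only [PosetGame.leftOptions, Set.mem_empty_iff_false, false_iff]
    rintro ⟨c, hc, -⟩
    exact h ⟨c, hc⟩

theorem mem_rightOptions_sem {p : S.Position} {G : PosetGame.{u, v} A} :
    G ∈ (S.sem p).rightOptions ↔ ∃ c, p c = none ∧ G = S.sem (paint p c false) := by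
  rw [sem]
  split_ifs with h
  · constructor
    · rintro ⟨c, rfl⟩
      exact ⟨c.1, c.2, rfl⟩
    · rintro ⟨c, hc, rfl⟩
      exact ⟨⟨c, hc⟩, rfl⟩
  · simp only [PosetGame.rightOptions, Set.mem_empty_iff_false, false_iff]
    rintro ⟨c, hc, -⟩
    exact h ⟨c, hc⟩

theorem sem_of_full {p : S.Position} (h : ∀ c, p c ≠ none) :
    S.sem p = PosetGame.atom (S.payoff fun c => (p c).getD false) := by
  rw [sem, dif_neg]
  rintro ⟨c, hc⟩
  exact h c hc

theorem full_of_isAtomic {p : S.Position} (h : (S.sem p).IsAtomic) (c : S.carrier) :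
    p c ≠ none := by
  intro hc
  obtain ⟨a, ha⟩ := h
  have := S.mem_leftOptions_sem.2 ⟨c, hc, rfl⟩
  simp [ha, PosetGame.leftOptions] at this

end SetColoringGame

/-- The order `some false < none < some true` on the states of a cell. -/
def CellLe (a b : Option Bool) : Prop := a = some false ∨ b = some true ∨ a = b

namespace SetColoringGame

variable {A : Type u} [PartialOrder A]

theorem cellLe_paint {α β ι : Type*} {a : ι → α} {b : ι → β} (ha : a.Injective)
    (hb : b.Injective) {p : α → Option Bool} {q : β → Option Bool}
    (h : ∀ i, CellLe (p (a i)) (q (b i))) (i : ι) (x : Bool) (j : ι) :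
    CellLe (paint p (a i) x (a j)) (paint q (b i) x (b j)) := by
  by_cases e : j = i
  · subst e
    simp [CellLe]
  · rw [paint_of_ne _ _ (ha.ne e), paint_of_ne _ _ (hb.ne e)]
    exact h j

theorem cellLe_paint_false {α β ι : Type*} {a : ι → α} {b : ι → β}
    {p : α → Option Bool} {q : β → Option Bool}
    (h : ∀ i, CellLe (p (a i)) (q (b i))) (c : α) (j : ι) :
    CellLe (paint p c false (a j)) (q (b j)) := by
  by_cases e : a j = c
  · rw [e]
    simp [CellLe]
  · rw [paint_of_ne _ _ e]
    exact h j

theorem cellLe_paint_true {α β ι : Type*} {a : ι → α} {b : ι → β}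
    {p : α → Option Bool} {q : β → Option Bool}
    (h : ∀ i, CellLe (p (a i)) (q (b i))) (c : β) (j : ι) :
    CellLe (p (a j)) (paint q c true (b j)) := by
  by_cases e : b j = c
  · rw [e]
    simp [CellLe]
  · rw [paint_of_ne _ _ e]
    exact h j

/-- Comparison of two set coloring games along matched cells `a i`, `b i`; payoffs are only
required to compare through the matched cells, all other cells are dead. -/
theorem sem_le_sem_aux (S T : SetColoringGame.{u, v} A) {ι : Type*} {a : ι → S.carrier}
    {b : ι → T.carrier} (ha : a.Injective) (hb : b.Injective)
    (hpay : ∀ s t, (∀ i, s (a i) ≤ t (b i)) → S.payoff s ≤ T.payoff t) (n : ℕ)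
    (p : S.Position) (q : T.Position)
    (hn : {x | p x = none}.ncard + {x | q x = none}.ncard = n)
    (h : ∀ i, CellLe (p (a i)) (q (b i))) :
    PosetGame.Le (S.sem p) (T.sem q) ∧ PosetGame.Tri (S.sem p) (T.sem q) := by
  have := S.finite_carrier
  have := T.finite_carrier
  induction n using Nat.strong_induction_on generalizing p q with
  | _ n ih =>
  have ihp : ∀ c x, p c = none → (∀ i, CellLe (paint p c x (a i)) (q (b i))) →
      PosetGame.Le (S.sem (paint p c x)) (T.sem q) ∧
        PosetGame.Tri (S.sem (paint p c x)) (T.sem q) := fun c x hc h' =>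
    ih _ (by have := ncard_paint_lt p c hc x; omega) _ _ rfl h'
  have ihq : ∀ c x, q c = none → (∀ i, CellLe (p (a i)) (paint q c x (b i))) →
      PosetGame.Le (S.sem p) (T.sem (paint q c x)) ∧
        PosetGame.Tri (S.sem p) (T.sem (paint q c x)) := fun c x hc h' =>
    ih _ (by have := ncard_paint_lt q c hc x; omega) _ _ rfl h'
  have ihpq : ∀ i x, p (a i) = none → q (b i) = none →
      PosetGame.Le (S.sem (paint p (a i) x)) (T.sem (paint q (b i) x)) := fun i x hp hq =>
    (ih _ (by
      have := ncard_paint_lt p _ hp x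
      have := ncard_paint_lt q _ hq x
      omega) _ _ rfl (cellLe_paint ha hb h i x)).1
  have tri : PosetGame.Tri (S.sem p) (T.sem q) := by
    by_cases hp : ∃ c, p c = none
    -- Right may color any empty cell, matched or dead: this only lowers the first position.
    · obtain ⟨c, hc⟩ := hp
      exact .right (S.mem_rightOptions_sem.2 ⟨c, hc, rfl⟩)
        (ihp c _ hc (cellLe_paint_false h c)).1
    by_cases hq : ∃ c, q c = none
    · obtain ⟨c, hc⟩ := hq
      exact .left (T.mem_leftOptions_sem.2 ⟨c, hc, rfl⟩)
        (ihq c _ hc (cellLe_paint_true h c)).1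
    push Not at hp hq
    rw [S.sem_of_full hp, T.sem_of_full hq]
    refine .atom (hpay _ _ fun i => ?_)
    rcases h i with e | e | e
    · simp [e]
    · simp [e, Bool.le_true]
    · simp [e]
  refine ⟨.intro (fun G hG => ?_) (fun G hG => ?_) fun _ => tri, tri⟩
  · obtain ⟨c, hc, rfl⟩ := S.mem_leftOptions_sem.1 hG
    -- A move in a matched cell that is also empty on the other side is copied there. Any other move
    -- keeps the cellwise comparison intact, so the inductive `Tri` already suffices.
    by_cases e : ∃ i, a i = c
    · obtain ⟨i, rfl⟩ := e
      rcases h i with e | e | e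
      · simp [e] at hc
      · refine (ihp _ _ hc fun j => ?_).2
        by_cases ej : j = i
        · exact .inr (.inl (ej ▸ e))
        · rw [paint_of_ne _ _ (ha.ne ej)]
          exact h j
      · rw [hc] at e
        exact .left (T.mem_leftOptions_sem.2 ⟨b i, e.symm, rfl⟩) (ihpq i _ hc e.symm)
    · refine (ihp _ _ hc fun j => ?_).2
      rw [paint_of_ne _ _ fun ej => e ⟨j, ej⟩]
      exact h j
  · obtain ⟨c, hc, rfl⟩ := T.mem_rightOptions_sem.1 hG
    by_cases e : ∃ i, b i = c
    · obtain ⟨i, rfl⟩ := e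
      rcases h i with e | e | e
      · refine (ihq _ _ hc fun j => ?_).2
        by_cases ej : j = i
        · exact .inl (ej ▸ e)
        · rw [paint_of_ne _ _ (hb.ne ej)]
          exact h j
      · simp [e] at hc
      · rw [hc] at e
        exact .right (S.mem_rightOptions_sem.2 ⟨a i, e, rfl⟩) (ihpq i _ e hc)
    · refine (ihq _ _ hc fun j => ?_).2
      rw [paint_of_ne _ _ fun ej => e ⟨j, ej⟩]
      exact h j

theorem sem_le_sem (S T : SetColoringGame.{u, v} A) {ι : Type*} {a : ι → S.carrier}
    {b : ι → T.carrier} (ha : a.Injective) (hb : b.Injective)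
    (hpay : ∀ s t, (∀ i, s (a i) ≤ t (b i)) → S.payoff s ≤ T.payoff t)
    (p : S.Position) (q : T.Position) (h : ∀ i, CellLe (p (a i)) (q (b i))) :
    PosetGame.Le (S.sem p) (T.sem q) :=
  (sem_le_sem_aux S T ha hb hpay _ p q rfl h).1

/-- The game `S` played on a larger set of cells, the additional cells being dead. -/
def extend (S : SetColoringGame.{u, v} A) {Z : Type v} [Finite Z] (a : S.carrier → Z) :
    SetColoringGame.{u, v} A where
  carrier := Z
  finite_carrier := inferInstance
  payoff t := S.payoff (t ∘ a)
  monotone_payoff _ _ h := S.monotone_payoff fun c => h (a c)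

theorem extend_value_equivalent (S : SetColoringGame.{u, v} A) {Z : Type v} [Finite Z]
    {a : S.carrier → Z} (ha : a.Injective) : (S.extend a).value.Equivalent S.value :=
  ⟨sem_le_sem (S.extend a) S ha Function.injective_id (fun _ _ h => S.monotone_payoff h) _ _
      fun _ => .inr (.inr rfl),
    sem_le_sem S (S.extend a) Function.injective_id ha (fun _ _ h => S.monotone_payoff h) _ _
      fun _ => .inr (.inr rfl)⟩

/-- Only the live cells are matched, so the two positions may even have different numbers of empty
dead cells. -/
theorem extend_sem_le_of_agree (S : SetColoringGame.{u, v} A) {Z : Type v} [Finite Z]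
    {a : S.carrier → Z} (ha : a.Injective) {p q : Z → Option Bool}
    (h : ∀ c, p (a c) = q (a c)) : PosetGame.Le ((S.extend a).sem p) ((S.extend a).sem q) :=
  sem_le_sem (S.extend a) (S.extend a) ha ha (fun _ _ h => S.monotone_payoff h) _ _
    fun c => .inr (.inr (h c))

theorem extend_sem_paint_le (S : SetColoringGame.{u, v} A) {Z : Type v} [Finite Z]
    {a : S.carrier → Z} (ha : a.Injective) {i : Z} (hi : ∀ x, a x ≠ i)
    (z : Z → Option Bool) (y : Bool) :
    PosetGame.Le ((S.extend a).sem (paint z i y)) ((S.extend a).sem z) ∧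
      PosetGame.Le ((S.extend a).sem z) ((S.extend a).sem (paint z i y)) :=
  ⟨S.extend_sem_le_of_agree ha fun x => paint_of_ne z y (hi x),
    S.extend_sem_le_of_agree ha fun x => (paint_of_ne z y (hi x)).symm⟩

theorem exists_injective (S : SetColoringGame.{u, v} A) {p n : ℕ} (hp : S.size = p)
    (h : p ≤ n) :
    ∃ a : S.carrier → ULift.{v} (Fin n), a.Injective := by
  have := S.finite_carrier
  let e := Finite.equivFin S.carrier
  refine ⟨fun x => ⟨Fin.castLE (hp.trans_le h) (e x)⟩, fun x y hxy => ?_⟩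
  exact e.injective (Fin.castLE_injective (hp.trans_le h) (ULift.up_injective hxy))

theorem sem_mono (S : SetColoringGame.{u, v} A) {p q : S.Position}
    (h : ∀ c, CellLe (p c) (q c)) : PosetGame.Le (S.sem p) (S.sem q) :=
  sem_le_sem S S Function.injective_id Function.injective_id
    (fun _ _ h => S.monotone_payoff h) _ _ h

end SetColoringGame

-- Treating both players, hence both inequalities, at once

namespace PosetGame

/-- The options available to a player (`true` is Left, `false` is Right). -/
def options {A : Type u} : Bool → PosetGame.{u, v} A → Set (PosetGame.{u, v} A)
  | true, G => G.leftOptions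
  | false, G => G.rightOptions

variable {A : Type u} [PartialOrder A]

/-- `Le`, or its opposite when `s = false`. -/
def LeOn : Bool → PosetGame.{u, v} A → PosetGame.{u, v} A → Prop
  | true, G, H => Le G H
  | false, G, H => Le H G

/-- `Tri`, or its opposite when `s = false`. -/
def TriOn : Bool → PosetGame.{u, v} A → PosetGame.{u, v} A → Prop
  | true, G, H => Tri G H
  | false, G, H => Tri H G

theorem LeOn.intro {s : Bool} {G H : PosetGame.{u, v} A}
    (h₁ : ∀ G' ∈ G.options s, TriOn s G' H) (h₂ : ∀ H' ∈ H.options (!s), TriOn s G H')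
    (h₃ : G.IsAtomic ∨ H.IsAtomic → TriOn s G H) : LeOn s G H := by
  cases s
  · exact Le.intro h₂ h₁ fun h => h₃ h.symm
  · exact Le.intro h₁ h₂ h₃

theorem TriOn.of_option {s : Bool} {G H G' : PosetGame.{u, v} A} (m : G' ∈ G.options (!s))
    (h : LeOn s G' H) : TriOn s G H := by
  cases s
  · exact Tri.left m h
  · exact Tri.right m h

theorem TriOn.of_option' {s : Bool} {G H H' : PosetGame.{u, v} A} (m : H' ∈ H.options s)
    (h : LeOn s G H') : TriOn s G H := by
  cases s
  · exact Tri.right m h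
  · exact Tri.left m h

theorem LeOn.refl (s : Bool) (G : PosetGame.{u, v} A) : LeOn s G G := by
  cases s <;> exact Le.refl G

theorem LeOn.trans {s : Bool} {G H K : PosetGame.{u, v} A} (h : LeOn s G H)
    (h' : LeOn s H K) : LeOn s G K := by
  cases s
  · exact Le.trans h' h
  · exact Le.trans h h'

theorem LeOn.trans_tri {s : Bool} {G H K : PosetGame.{u, v} A} (h : LeOn s G H)
    (h' : TriOn s H K) : TriOn s G K := by
  cases s
  · exact Tri.trans_le h' h
  · exact Le.trans_tri h h'

/-- The order of an ordered type, or its opposite when `s = false`. -/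
def ordOn {α : Type*} [LE α] : Bool → α → α → Prop
  | true, a, b => a ≤ b
  | false, a, b => b ≤ a

theorem TriOn.atom {s : Bool} {a b : A} (h : ordOn s a b) :
    TriOn s (atom a : PosetGame.{u, v} A) (PosetGame.atom b) := by
  cases s <;> exact Tri.atom h

end PosetGame

namespace SetColoringGame

open PosetGame

variable {A : Type u} [PartialOrder A]

theorem mem_options_sem (S : SetColoringGame.{u, v} A) {p : S.Position} {s : Bool}
    {G : PosetGame.{u, v} A} :
    G ∈ (S.sem p).options s ↔ ∃ c, p c = none ∧ G = S.sem (paint p c s) := by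
  cases s
  · exact S.mem_rightOptions_sem
  · exact S.mem_leftOptions_sem

theorem sem_paint_leOn (S : SetColoringGame.{u, v} A) (p : S.Position) (c : S.carrier)
    (s : Bool) : LeOn s (S.sem (paint p c !s)) (S.sem p) := by
  cases s
  · exact S.sem_mono (cellLe_paint_true (a := id) (b := id) (fun _ => .inr (.inr rfl)) c)
  · exact S.sem_mono (cellLe_paint_false (a := id) (b := id) (fun _ => .inr (.inr rfl)) c)

end SetColoringGame

-- Schematic games and the search on control cells

/-- Choose among four values: `⊤` for `(true, true)`, `⊥` for `(false, false)`, and the two given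
ones otherwise. -/
def select {α : Type*} (top bot x y : α) : Bool × Bool → α
  | (true, true) => top
  | (true, false) => x
  | (false, true) => y
  | (false, false) => bot

theorem select_le_select {A : Type u} [PartialOrder A] [BoundedOrder A] {x y x' y' : A}
    {d e : Bool × Bool} (h : d ≤ e) (hx : x ≤ x') (hy : y ≤ y') :
    select ⊤ ⊥ x y d ≤ select ⊤ ⊥ x' y' e := by
  obtain ⟨_ | _, _ | _⟩ := d <;> obtain ⟨_ | _, _ | _⟩ := e <;>
    first | exact bot_le | exact le_top | exact hx | exact hy | (exact absurd h (by decide))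

/-- Schematic games built from `⊤`, `⊥` and two unknown games. -/
inductive Plan
  | leaf (d : Bool × Bool) : Plan
  | cut (l₁ l₂ r₁ r₂ : Plan) : Plan

namespace Plan

open PosetGame

/-- The game obtained by substituting `G` and `H` for the two unknowns. -/
def eval {A : Type u} [PartialOrder A] [BoundedOrder A] (G H : PosetGame.{u, v} A) :
    Plan → PosetGame.{u, v} A
  | leaf d => select (atom ⊤) (atom ⊥) G H d
  | cut l₁ l₂ r₁ r₂ => pair (l₁.eval G H) (l₂.eval G H) (r₁.eval G H) (r₂.eval G H)

/-- The options of a player in a schematic game; those of the unknown games are not counted. -/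
def options : Bool → Plan → List Plan
  | _, leaf _ => []
  | true, cut l₁ l₂ _ _ => [l₁, l₂]
  | false, cut _ _ r₁ r₂ => [r₁, r₂]

/-- The property `Q` holds for all followers. -/
def Hereditarily (Q : Plan → Prop) : Plan → Prop
  | leaf d => Q (leaf d)
  | cut l₁ l₂ r₁ r₂ => Q (cut l₁ l₂ r₁ r₂) ∧ l₁.Hereditarily Q ∧ l₂.Hereditarily Q ∧
      r₁.Hereditarily Q ∧ r₂.Hereditarily Q

theorem Hereditarily.self {Q : Plan → Prop} {n : Plan} (h : n.Hereditarily Q) : Q n := by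
  cases n
  · exact h
  · exact h.1

theorem Hereditarily.option {Q : Plan → Prop} {n m : Plan} {s : Bool} (h : n.Hereditarily Q)
    (hm : m ∈ n.options s) : m.Hereditarily Q := by
  cases n with
  | leaf d => simp [options] at hm
  | cut l₁ l₂ r₁ r₂ =>
    obtain ⟨-, h₁, h₂, h₃, h₄⟩ := h
    cases s <;> simp only [options, List.mem_cons, List.not_mem_nil, or_false] at hm <;>
      rcases hm with rfl | rfl <;> assumption

variable {A : Type u} [PartialOrder A] [BoundedOrder A]

theorem mem_options_eval_cut {G H K : PosetGame.{u, v} A} {s : Bool} {l₁ l₂ r₁ r₂ : Plan} :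
    K ∈ ((cut l₁ l₂ r₁ r₂).eval G H).options s ↔
      ∃ m ∈ (cut l₁ l₂ r₁ r₂).options s, K = m.eval G H := by
  cases s
  · simp only [eval, PosetGame.options, rightOptions_pair, options]
    simp
  · simp only [eval, PosetGame.options, leftOptions_pair, options]
    simp

theorem eval_mem_options {G H : PosetGame.{u, v} A} {s : Bool} {n m : Plan}
    (h : m ∈ n.options s) : m.eval G H ∈ (n.eval G H).options s := by
  cases n with
  | leaf d => simp [options] at h
  | cut => exact mem_options_eval_cut.2 ⟨m, h, rfl⟩

/-- Decide, by a search of bounded depth, whether the position `c` of a board of control cells is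
below the schematic game `n` in the sense of `LeOn s` (for the flag `true`) or of `TriOn s` (for the
flag `false`). -/
def sim {k : ℕ} (κ : (Fin k → Bool) → Bool × Bool) (s : Bool) :
    ℕ → Bool → (Fin k → Option Bool) → Plan → Bool
  | 0, _, _, _ => false
  | f + 1, true, c, n =>
    (List.finRange k).all
      (fun i => (c i).isSome || sim κ s f false (Function.update c i (some s)) n) &&
    (n.options (!s)).all (fun m => sim κ s f false c m) &&
    (match n with
      | leaf _ => sim κ s f false c n
      | cut _ _ _ _ => !((List.finRange k).all fun i => (c i).isSome) || sim κ s f false c n)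
  | f + 1, false, c, n =>
    (n.options s).any (fun m => sim κ s f true c m) ||
    (List.finRange k).any
      (fun i => (c i).isNone && sim κ s f true (Function.update c i (some !s)) n) ||
    (match n with
      | leaf d => ((List.finRange k).all fun i => (c i).isSome) &&
          (if s then decide (κ (fun i => (c i).getD false) ≤ d)
            else decide (d ≤ κ (fun i => (c i).getD false)))
      | cut _ _ _ _ => false)

end Plan

-- Control cells added to a board, and soundness of the search

namespace SetColoringGame

open PosetGame

/-- Combine the states of the control cells and of the other cells. -/
def join {Z : Type v} {k : ℕ} (c : Fin k → Option Bool) (z : Z → Option Bool) :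
    ULift.{v} (Fin k) ⊕ Z → Option Bool :=
  Sum.elim (fun i => c i.down) z

theorem paint_join_inl {Z : Type v} {k : ℕ} (c : Fin k → Option Bool) (z : Z → Option Bool)
    (i : Fin k) (x : Bool) :
    paint (join c z) (.inl ⟨i⟩) x = join (Function.update c i (some x)) z := by
  refine funext fun y => ?_
  rcases y with ⟨⟨j⟩⟩ | j
  · by_cases e : j = i
    · subst e
      simp [join]
    · rw [paint_of_ne _ _ (by simpa using e)]
      simp [join, e]
  · rw [paint_of_ne _ _ (by simp)]
    rfl

theorem paint_join_inr {Z : Type v} {k : ℕ} (c : Fin k → Option Bool) (z : Z → Option Bool)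
    (i : Z) (x : Bool) :
    paint (join c z) (.inr i) x = join c (paint z i x) := by
  refine funext fun y => ?_
  rcases y with ⟨⟨j⟩⟩ | j
  · rw [paint_of_ne _ _ (by simp)]
    rfl
  · by_cases e : j = i
    · subst e
      simp [join]
    · rw [paint_of_ne _ _ (by simpa using e)]
      simp [join, paint_of_ne _ _ e]

variable {A : Type u} [PartialOrder A] [BoundedOrder A] {Z : Type v} [Finite Z] {k : ℕ}
  {κ : (Fin k → Bool) → Bool × Bool}

/-- The game with `k` control cells whose coloring determines, through `κ`, whether the outcome is
`⊤`, `⊥` or that of one of the games `S`, `T` played on the cells `Z`. -/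
def control (κ : (Fin k → Bool) → Bool × Bool) (hκ : Monotone κ) (S T : SetColoringGame.{u, v} A)
    (a : S.carrier → Z) (b : T.carrier → Z) : SetColoringGame.{u, v} A where
  carrier := ULift.{v} (Fin k) ⊕ Z
  finite_carrier := inferInstance
  payoff t := select ⊤ ⊥ (S.payoff fun x => t (.inr (a x))) (T.payoff fun x => t (.inr (b x)))
    (κ fun i => t (.inl ⟨i⟩))
  monotone_payoff _ _ h := select_le_select (hκ fun _ => h _) (S.monotone_payoff fun _ => h _)
    (T.monotone_payoff fun _ => h _)

variable {hκ : Monotone κ} {S T : SetColoringGame.{u, v} A} {a : S.carrier → Z}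
  {b : T.carrier → Z} {s : Bool}

/-- The schematic game `n` with the positions `z` of `S` and `T` substituted. -/
noncomputable def evalAt (a : S.carrier → Z) (b : T.carrier → Z) (n : Plan)
    (z : Z → Option Bool) : PosetGame.{u, v} A :=
  n.eval ((S.extend a).sem z) ((T.extend b).sem z)

/-- Extra moves in the cells `Z` do not hurt in the schematic game `n`. -/
def Stable (a : S.carrier → Z) (b : T.carrier → Z) (n : Plan) : Prop :=
  ∀ s z i, z i = none → TriOn s (evalAt a b n (paint z i s)) (evalAt a b n z)

/-- For an unknown game, the colored position is itself an option of the original one, even when the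
cell is dead in that game. The leaves `⊤` and `⊥` ignore the board. -/
theorem stable_leaf (d : Bool × Bool) : Stable a b (.leaf d) := by
  intro s z i hi
  obtain ⟨_ | _, _ | _⟩ := d
  · exact TriOn.atom (by cases s <;> exact le_rfl)
  · exact TriOn.of_option' ((T.extend b).mem_options_sem.2 ⟨i, hi, rfl⟩) (LeOn.refl _ _)
  · exact TriOn.of_option' ((S.extend a).mem_options_sem.2 ⟨i, hi, rfl⟩) (LeOn.refl _ _)
  · exact TriOn.atom (by cases s <;> exact le_rfl)

theorem evalAt_leaf_paint_leOn (d : Bool × Bool) (z : Z → Option Bool) (i : Z) :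
    LeOn s (evalAt a b (.leaf d) (paint z i !s)) (evalAt a b (.leaf d) z) := by
  obtain ⟨_ | _, _ | _⟩ := d
  · exact LeOn.refl _ _
  · exact (T.extend b).sem_paint_leOn z i s
  · exact (S.extend a).sem_paint_leOn z i s
  · exact LeOn.refl _ _

theorem options_evalAt_leaf {d : Bool × Bool} {z : Z → Option Bool} {K : PosetGame.{u, v} A}
    (h : K ∈ (evalAt a b (.leaf d) z).options s) :
    ∃ i, z i = none ∧ K = evalAt a b (.leaf d) (paint z i s) := by
  obtain ⟨_ | _, _ | _⟩ := d
  · cases s <;> exact absurd h (Set.notMem_empty _)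
  · exact (T.extend b).mem_options_sem.1 h
  · exact (S.extend a).mem_options_sem.1 h
  · cases s <;> exact absurd h (Set.notMem_empty _)

/-- Induction on the number of empty board cells eliminates the board. The hypotheses `h₁` and `h₂`
concern only moves in control cells and options of the schematic game; `h₃` covers the
configurations in which one side could be atomic. -/
theorem control_sem_leOn_of_step {c : Fin k → Option Bool} {n : Plan} (hst : Stable a b n)
    (h₁ : ∀ i, c i = none → ∀ z, TriOn s
      ((control κ hκ S T a b).sem (join (Function.update c i (some s)) z)) (evalAt a b n z))
    (h₂ : ∀ m ∈ n.options (!s), ∀ z,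
      TriOn s ((control κ hκ S T a b).sem (join c z)) (evalAt a b m z))
    (h₃ : ((∀ i, c i ≠ none) ∨ ∃ d, n = .leaf d) → ∀ z, (∀ i x, z i = none →
        LeOn s ((control κ hκ S T a b).sem (join c (paint z i x))) (evalAt a b n (paint z i x))) →
      TriOn s ((control κ hκ S T a b).sem (join c z)) (evalAt a b n z))
    (z : Z → Option Bool) :
    LeOn s ((control κ hκ S T a b).sem (join c z)) (evalAt a b n z) := by
  induction hN : {i | z i = none}.ncard using Nat.strong_induction_on generalizing z with
  | _ N ih =>
  replace ih : ∀ i x, z i = none → LeOn s ((control κ hκ S T a b).sem (join c (paint z i x)))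
      (evalAt a b n (paint z i x)) := fun i x hi => ih _ (hN ▸ ncard_paint_lt z i hi x) _ rfl
  refine LeOn.intro (fun K m => ?_) (fun K m => ?_) fun hat => ?_
  · obtain ⟨⟨⟨i⟩⟩ | i, hi, rfl⟩ := (control κ hκ S T a b).mem_options_sem.1 m
    · exact (congrArg (fun p => TriOn s ((control κ hκ S T a b).sem p) _)
        (paint_join_inl c z i s)).mpr (h₁ i hi z)
    -- A board move by `s`: compare after making the same move on both sides, then undo it in the
    -- schematic game by stability.
    · exact (congrArg (fun p => TriOn s ((control κ hκ S T a b).sem p) _)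
        (paint_join_inr c z i s)).mpr ((ih i s hi).trans_tri (hst s z i hi))
  · cases n with
    | leaf d =>
      -- The opponent's move in an unknown game is a board move, which is copied.
      obtain ⟨i, hi, rfl⟩ := options_evalAt_leaf m
      exact TriOn.of_option ((control κ hκ S T a b).mem_options_sem.2
        ⟨.inr i, hi, congrArg _ (paint_join_inr ..).symm⟩) (ih i _ hi)
    | cut l₁ l₂ r₁ r₂ =>
      obtain ⟨n', hn', rfl⟩ := Plan.mem_options_eval_cut.1 m
      exact h₂ n' hn' z
  · refine h₃ ?_ z ih
    rcases hat with hat | hat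
    · exact .inl fun i => (control κ hκ S T a b).full_of_isAtomic hat (.inl ⟨i⟩)
    · cases n with
      | leaf d => exact .inr ⟨d, rfl⟩
      | cut => exact absurd hat (by exact not_isAtomic_pair _ _ _ _)

theorem control_sem_triOn_of_full_of_leOn {c : Fin k → Option Bool} (hc : ∀ i, c i ≠ none)
    {d : Bool × Bool} (hd : ordOn s (κ fun i => (c i).getD false) d) (z : Z → Option Bool)
    (ih : ∀ i x, z i = none → LeOn s ((control κ hκ S T a b).sem (join c (paint z i x)))
      (evalAt a b (.leaf d) (paint z i x))) :
    TriOn s ((control κ hκ S T a b).sem (join c z)) (evalAt a b (.leaf d) z) := by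
  by_cases hz : ∃ i, z i = none
  · obtain ⟨i, hi⟩ := hz
    -- The opponent of `s` spends a move on the board; by monotonicity this can be undone in the
    -- leaf.
    exact TriOn.of_option ((control κ hκ S T a b).mem_options_sem.2
      ⟨.inr i, hi, congrArg _ (paint_join_inr ..).symm⟩)
      ((ih i _ hi).trans (evalAt_leaf_paint_leOn d z i))
  · push Not at hz
    have e : evalAt a b (.leaf d) z = atom (select ⊤ ⊥ (S.payoff fun x => (z (a x)).getD false)
        (T.payoff fun x => (z (b x)).getD false) d) := by
      obtain ⟨_ | _, _ | _⟩ := d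
      · rfl
      · exact (T.extend b).sem_of_full hz
      · exact (S.extend a).sem_of_full hz
      · rfl
    have e' := (control κ hκ S T a b).sem_of_full (p := join c z)
      (Sum.rec (fun i => hc i.down) hz)
    refine e.symm ▸ (congrArg (fun G => TriOn s G _) e').mpr (TriOn.atom ?_)
    cases s
    · exact select_le_select hd le_rfl le_rfl
    · exact select_le_select hd le_rfl le_rfl

/-- Once the control cells are full, no control moves remain and a leaf has no schematic options, so
the induction step needs only its third hypothesis, which the preceding lemma supplies. -/
theorem control_sem_triOn_of_full {c : Fin k → Option Bool} (hc : ∀ i, c i ≠ none)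
    {d : Bool × Bool} (hd : ordOn s (κ fun i => (c i).getD false) d) (z : Z → Option Bool) :
    TriOn s ((control κ hκ S T a b).sem (join c z)) (evalAt a b (.leaf d) z) :=
  control_sem_triOn_of_full_of_leOn hc hd z fun i x _ =>
    control_sem_leOn_of_step (stable_leaf d) (fun j hj => absurd hj (hc j))
      (by simp [Plan.options])
      (fun _ z' h => control_sem_triOn_of_full_of_leOn hc hd z' h) (paint z i x)

theorem control_sem_of_sim (f : ℕ) : ∀ (c : Fin k → Option Bool) (n : Plan),
    n.Hereditarily (Stable a b) →
    (Plan.sim κ s f true c n = true → ∀ z,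
      LeOn s ((control κ hκ S T a b).sem (join c z)) (evalAt a b n z)) ∧
    (Plan.sim κ s f false c n = true → ∀ z,
      TriOn s ((control κ hκ S T a b).sem (join c z)) (evalAt a b n z)) := by
  induction f with
  | zero => intro c n _; exact ⟨fun h => by simp [Plan.sim] at h, fun h => by simp [Plan.sim] at h⟩
  | succ f ih =>
    intro c n hn
    constructor
    · intro h
      simp only [Plan.sim, Bool.and_eq_true, List.all_eq_true, Bool.or_eq_true,
        List.mem_finRange, forall_const] at h
      obtain ⟨⟨h₁, h₂⟩, h₃⟩ := h
      refine control_sem_leOn_of_step hn.self (fun i hi => ?_) (fun m hm => ?_) ?_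
      · exact (ih _ n hn).2 ((h₁ i).resolve_left (by simp [hi]))
      · exact (ih _ m (hn.option hm)).2 (h₂ m hm)
      · intro h z _
        refine (ih _ n hn).2 ?_ z
        cases n with
        | leaf d => exact h₃
        | cut =>
          rcases h with h | ⟨d, h⟩
          -- A composite plan is never atomic, so `Tri` is required here only when all control cells
          -- are colored.
          · refine (Bool.or_eq_true _ _ ▸ h₃).resolve_left ?_
            simpa [Option.isSome_iff_ne_none] using h
          · cases h
    · intro h z
      simp only [Plan.sim, Bool.or_eq_true, List.any_eq_true, List.mem_finRange, true_and,
        Bool.and_eq_true] at h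
      rcases h with (⟨m, hm, h⟩ | ⟨i, hi, h⟩) | h
      · exact TriOn.of_option' (Plan.eval_mem_options hm) ((ih c m (hn.option hm)).1 h z)
      · refine TriOn.of_option ((control κ hκ S T a b).mem_options_sem.2
          ⟨.inl ⟨i⟩, ?_, congrArg _ (paint_join_inl ..).symm⟩) ((ih _ n hn).1 h z)
        exact Option.isNone_iff_eq_none.1 hi
      · cases n with
        | leaf d =>
          simp only [Bool.and_eq_true, List.all_eq_true, List.mem_finRange, forall_const] at h
          refine control_sem_triOn_of_full (fun i => by
            simpa [Option.isSome_iff_ne_none] using h.1 i) ?_ z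
          cases s
          · simpa [ordOn] using h.2
          · simpa [ordOn] using h.2
        | cut => simp at h

theorem control_value_equivalent {n : Plan} (hn : n.Hereditarily (Stable a b)) (f : ℕ)
    (h : ∀ s, Plan.sim κ s f true (fun _ => none) n = true) :
    (evalAt a b n fun _ => none).Equivalent (control κ hκ S T a b).value := by
  have e : (join (fun _ : Fin k => none) fun _ : Z => none) = fun _ => none := by
    refine funext fun x => ?_
    rcases x with i | i <;> rfl
  refine (congrArg (fun p => PosetGame.Equivalent _ ((control κ hκ S T a b).sem p)) e).mp ⟨?_, ?_⟩
  -- `LeOn false` puts the schematic game below the control game, `LeOn true` the reverse.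
  exacts [(control_sem_of_sim (s := false) f _ n hn).1 (h _) _,
    (control_sem_of_sim (s := true) f _ n hn).1 (h _) _]

theorem control_size (hκ : Monotone κ) : (control κ hκ S T a b).size = Nat.card Z + k := by
  have : (control κ hκ S T a b).carrier = (ULift.{v} (Fin k) ⊕ Z) := rfl
  rw [size, this, Nat.card_sum]
  simp [add_comm]

end SetColoringGame

-- Inequalities for the gadgets and their stability

namespace PosetGame

variable {A : Type u} [PartialOrder A] [BoundedOrder A]

theorem le_pair_top {G K : PosetGame.{u, v} A} (h : Tri K G) :
    Le K (pair (atom ⊤) (atom ⊤) G G) := by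
  refine Le.intro (fun K' _ => ?_) (fun G' m => ?_) fun _ => ?_
  · exact Tri.left (H' := atom ⊤) (by simp [leftOptions_pair]) (le_atom_top _)
  · obtain rfl : G' = G := by simpa [rightOptions_pair] using m
    exact h
  · exact Tri.left (H' := atom ⊤) (by simp [leftOptions_pair]) (le_atom_top _)

theorem pair_bot_le {G K : PosetGame.{u, v} A} (h : Tri G K) :
    Le (pair G G (atom ⊥) (atom ⊥)) K := by
  refine Le.intro (fun G' m => ?_) (fun K' _ => ?_) fun _ => ?_
  · obtain rfl : G' = G := by simpa [leftOptions_pair] using m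
    exact h
  · exact Tri.right (G' := atom ⊥) (by simp [rightOptions_pair]) (atom_bot_le _)
  · exact Tri.right (G' := atom ⊥) (by simp [rightOptions_pair]) (atom_bot_le _)

theorem tri_pair_top (G H : PosetGame.{u, v} A) (K : PosetGame.{u, v} A) :
    Tri K (pair (atom ⊤) (atom ⊤) G H) :=
  Tri.left (H' := atom ⊤) (by simp [leftOptions_pair]) (le_atom_top _)

theorem pair_bot_tri (G H : PosetGame.{u, v} A) (K : PosetGame.{u, v} A) :
    Tri (pair G H (atom ⊥) (atom ⊥)) K :=
  Tri.right (G' := atom ⊥) (by simp [rightOptions_pair]) (atom_bot_le _)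

end PosetGame

namespace Plan

open PosetGame

/-- The first unknown game. -/
def fst : Plan := leaf (true, false)

/-- The second unknown game. -/
def snd : Plan := leaf (false, true)

/-- Left forcing gadget. -/
def leftForcing (m : Plan) : Plan := cut (leaf (true, true)) (leaf (true, true)) m m

/-- Right forcing gadget. -/
def rightForcing (m : Plan) : Plan := cut m m (leaf (false, false)) (leaf (false, false))

/-- Choice gadget. -/
def choice : Plan :=
  cut (leftForcing fst) (leftForcing snd) (rightForcing fst) (rightForcing snd)

/-- Coupling gadget. -/
def coupling : Plan := cut fst (leftForcing snd) (rightForcing fst) snd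

variable {A : Type u} [PartialOrder A] [BoundedOrder A]

/-- Right moves to `{G | ⊥}`, threatening `⊥`; when Left answers with `G`, the comparison goes
through the left option `{⊤ | G'}` on the other side. Only the first unknown matters, so nothing is
needed about `H` and `H'`. -/
theorem choice_eval_tri {G G' H H' : PosetGame.{u, v} A} (h : Tri G G') :
    Tri (choice.eval G H) (choice.eval G' H') := by
  refine Tri.right (G' := (rightForcing fst).eval G H) ?_ (pair_bot_le (Tri.left
    (H' := (leftForcing fst).eval G' H') ?_ (le_pair_top h)))
  · exact eval_mem_options (s := false) (n := choice) (by simp [choice, options])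
  · exact eval_mem_options (s := true) (n := choice) (by simp [choice, options])

/-- Here `G'` is itself a left option and `H` itself a right option, so the corresponding argument
needs `Le` in one component instead of `Tri`. -/
theorem coupling_eval_tri {G G' H H' : PosetGame.{u, v} A} (h : Le G G' ∨ Le H H') :
    Tri (coupling.eval G H) (coupling.eval G' H') := by
  rcases h with h | h
  · refine Tri.right (G' := (rightForcing fst).eval G H) ?_ (pair_bot_le (Tri.left
      (H' := fst.eval G' H') ?_ h))
    · exact eval_mem_options (s := false) (n := coupling) (by simp [coupling, options])
    · exact eval_mem_options (s := true) (n := coupling) (by simp [coupling, options])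
  · refine Tri.left (H' := (leftForcing snd).eval G' H') ?_ (le_pair_top (Tri.right
      (G' := snd.eval G H) ?_ h))
    · exact eval_mem_options (s := true) (n := coupling) (by simp [coupling, options])
    · exact eval_mem_options (s := false) (n := coupling) (by simp [coupling, options])

theorem leftForcing_eval_equivalent {K : PosetGame.{u, v} A} {G H : PosetGame.{u, v} A}
    {m : Plan} (h : K.Equivalent (m.eval G H)) :
    (PosetGame.leftForcing K).Equivalent ((leftForcing m).eval G H) :=
  single_equivalent_pair ⟨Le.refl _, Le.refl _⟩ h

theorem rightForcing_eval_equivalent {K : PosetGame.{u, v} A} {G H : PosetGame.{u, v} A}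
    {m : Plan} (h : K.Equivalent (m.eval G H)) :
    (PosetGame.rightForcing K).Equivalent ((rightForcing m).eval G H) :=
  single_equivalent_pair h ⟨Le.refl _, Le.refl _⟩

end Plan

namespace SetColoringGame

open PosetGame

variable {A : Type u} [PartialOrder A] [BoundedOrder A] {Z : Type v} [Finite Z]
  {S T : SetColoringGame.{u, v} A} {a : S.carrier → Z} {b : T.carrier → Z}

theorem hereditarily_stable_leftForcing (d : Bool × Bool) :
    (Plan.leftForcing (.leaf d)).Hereditarily (Stable a b) := by
  refine ⟨fun s z i _ => ?_, stable_leaf _, stable_leaf _, stable_leaf _, stable_leaf _⟩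
  cases s <;> exact tri_pair_top _ _ _

theorem hereditarily_stable_rightForcing (d : Bool × Bool) :
    (Plan.rightForcing (.leaf d)).Hereditarily (Stable a b) := by
  refine ⟨fun s z i _ => ?_, stable_leaf _, stable_leaf _, stable_leaf _, stable_leaf _⟩
  cases s <;> exact pair_bot_tri _ _ _

theorem hereditarily_stable_choice : Plan.choice.Hereditarily (Stable a b) := by
  refine ⟨fun s z i hi => ?_, hereditarily_stable_leftForcing _,
    hereditarily_stable_leftForcing _, hereditarily_stable_rightForcing _,
    hereditarily_stable_rightForcing _⟩
  have h : Stable a b Plan.fst := stable_leaf _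
  cases s
  · exact Plan.choice_eval_tri (h false z i hi)
  · exact Plan.choice_eval_tri (h true z i hi)

theorem hereditarily_stable_coupling (ha : a.Injective) (hb : b.Injective)
    (hab : ∀ x y, a x ≠ b y) : Plan.coupling.Hereditarily (Stable a b) := by
  refine ⟨fun s z i _ => ?_, stable_leaf _, hereditarily_stable_leftForcing _,
    hereditarily_stable_rightForcing _, stable_leaf _⟩
  -- The images are disjoint, so the cell is dead in at least one of the games, which a move there
  -- leaves unchanged up to equivalence.
  have h : (∀ x, a x ≠ i) ∨ ∀ y, b y ≠ i := by
    by_contra! h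
    obtain ⟨⟨x, rfl⟩, y, e⟩ := h
    exact hab x y e.symm
  cases s
  · exact Plan.coupling_eval_tri (h.imp (fun h => (extend_sem_paint_le _ ha h z false).2)
      fun h => (extend_sem_paint_le _ hb h z false).2)
  · exact Plan.coupling_eval_tri (h.imp (fun h => (extend_sem_paint_le _ ha h z true).1)
      fun h => (extend_sem_paint_le _ hb h z true).1)

-- The concrete control functions and their verification

/-- The two control cells of the choice gadget select the outcome. -/
def choiceControl (c : Fin 2 → Bool) : Bool × Bool := (c 0, c 1)

/-- The control cells of the coupling gadget. -/
def couplingControl (c : Fin 5 → Bool) : Bool × Bool :=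
  (c 2 && c 3 || c 2 && c 1 || c 3 && c 0, c 0 && c 1 || c 0 && c 4 || c 1 && c 4)

theorem monotone_choiceControl : Monotone choiceControl := fun _ _ h => ⟨h 0, h 1⟩

theorem and_le_and {a b c d : Bool} (h : a ≤ c) (h' : b ≤ d) : (a && b) ≤ (c && d) :=
  inf_le_inf h h'

theorem or_le_or {a b c d : Bool} (h : a ≤ c) (h' : b ≤ d) : (a || b) ≤ (c || d) :=
  sup_le_sup h h'

theorem monotone_couplingControl : Monotone couplingControl := fun _ _ h =>
  ⟨or_le_or (or_le_or (and_le_and (h 2) (h 3)) (and_le_and (h 2) (h 1)))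
      (and_le_and (h 3) (h 0)),
    or_le_or (or_le_or (and_le_and (h 0) (h 1)) (and_le_and (h 0) (h 4)))
      (and_le_and (h 1) (h 4))⟩

/-- A single control cell deciding between `⊤` and the game `S`. -/
def leftControl (c : Fin 1 → Bool) : Bool × Bool := (true, c 0)

/-- A single control cell deciding between the game `S` and `⊥`. -/
def rightControl (c : Fin 1 → Bool) : Bool × Bool := (c 0, false)

theorem monotone_leftControl : Monotone leftControl := fun _ _ h => ⟨le_rfl, h 0⟩

theorem monotone_rightControl : Monotone rightControl := fun _ _ h => ⟨h 0, le_rfl⟩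

theorem sim_leftControl (s : Bool) :
    Plan.sim leftControl s 8 true (fun _ => none) (Plan.leftForcing Plan.fst) = true := by
  cases s <;> decide +kernel

theorem sim_rightControl (s : Bool) :
    Plan.sim rightControl s 8 true (fun _ => none) (Plan.rightForcing Plan.fst) = true := by
  cases s <;> decide +kernel

theorem sim_choiceControl (s : Bool) :
    Plan.sim choiceControl s 10 true (fun _ => none) Plan.choice = true := by
  cases s <;> decide +kernel

/-- Left's option `G` is met by coloring cell 2: pairing cells 1 and 3 then secures the first
coordinate. For `{⊤ | H}` Left takes cell 0, which secures the second coordinate by pairing 1 and 4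
and threatens `⊤` through cell 3. Right has the dual moves, since the second coordinate is self-dual
and the first is so up to swapping cells 0 and 1. Depth 16 always suffices: at most two calls occur
for each value of the number of empty control cells plus the remaining plan depth, which starts at 5
+ 2. -/
theorem sim_couplingControl (s : Bool) :
    Plan.sim couplingControl s 16 true (fun _ => none) Plan.coupling = true := by
  cases s <;> decide +kernel

end SetColoringGame

-- Assembly

theorem proposition4p1 {A : Type u} [PartialOrder A] [BoundedOrder A]
    (G H : PosetGame.{u, v} A) (p q : ℕ)
    (hG : G.RealizableWithSize p) (hH : H.RealizableWithSize q) :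
    ((PosetGame.leftForcing G).RealizableWithSize (p + 1) ∧
      (PosetGame.rightForcing G).RealizableWithSize (p + 1)) ∧
    (PosetGame.choiceGadget G H).RealizableWithSize (max p q + 2) ∧
    (PosetGame.couplingGadget G H).RealizableWithSize (p + q + 5) := by
  open SetColoringGame in
  obtain ⟨S, hS, eS⟩ := hG
  obtain ⟨T, hT, eT⟩ := hH
  have := S.finite_carrier
  have := T.finite_carrier
  have extend_equivalent : ∀ {K : PosetGame.{u, v} A} {S : SetColoringGame.{u, v} A}
      {Z : Type v} [Finite Z] {a : S.carrier → Z}, K.Equivalent S.value → a.Injective →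
      K.Equivalent (S.extend a).value :=
    fun h ha => h.trans (extend_value_equivalent _ ha).symm
  have eS' := extend_equivalent eS Function.injective_id
  refine ⟨⟨?_, ?_⟩, ?_, ?_⟩
  · refine ⟨control leftControl monotone_leftControl S S id id,
      (control_size _).trans (congrArg (· + 1) hS), ?_⟩
    exact (Plan.leftForcing_eval_equivalent (m := Plan.fst) eS').trans
      (control_value_equivalent (hereditarily_stable_leftForcing _) 8 sim_leftControl)
  · refine ⟨control rightControl monotone_rightControl S S id id,
      (control_size _).trans (congrArg (· + 1) hS), ?_⟩
    exact (Plan.rightForcing_eval_equivalent (m := Plan.fst) eS').trans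
      (control_value_equivalent (hereditarily_stable_rightForcing _) 8 sim_rightControl)
  -- Both games share one board of `max p q` cells; the overlap is arbitrary.
  · obtain ⟨a, ha⟩ := exists_injective _ hS (le_max_left p q)
    obtain ⟨b, hb⟩ := exists_injective _ hT (le_max_right p q)
    have e₁ := extend_equivalent eS ha
    have e₂ := extend_equivalent eT hb
    refine ⟨control choiceControl monotone_choiceControl S T a b,
      (control_size _).trans (by simp), ?_⟩
    exact (PosetGame.pair_equivalent_pair
      (Plan.leftForcing_eval_equivalent (m := Plan.fst) e₁)
      (Plan.leftForcing_eval_equivalent (m := Plan.snd) e₂)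
      (Plan.rightForcing_eval_equivalent (m := Plan.fst) e₁)
      (Plan.rightForcing_eval_equivalent (m := Plan.snd) e₂)).trans
      (control_value_equivalent hereditarily_stable_choice 10 sim_choiceControl)
  · have ha : Function.Injective (Sum.inl : S.carrier → S.carrier ⊕ T.carrier) :=
      Sum.inl_injective
    have hb : Function.Injective (Sum.inr : T.carrier → S.carrier ⊕ T.carrier) :=
      Sum.inr_injective
    have e₁ := extend_equivalent eS ha
    have e₂ := extend_equivalent eT hb
    refine ⟨control couplingControl monotone_couplingControl S T Sum.inl Sum.inr,
      (control_size _).trans ?_, ?_⟩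
    · rw [Nat.card_sum, ← hS, ← hT]
      rfl
    exact (PosetGame.pair_equivalent_pair e₁
      (Plan.leftForcing_eval_equivalent (m := Plan.snd) e₂)
      (Plan.rightForcing_eval_equivalent (m := Plan.fst) e₁) e₂).trans
      (control_value_equivalent (hereditarily_stable_coupling ha hb (by simp)) 16
        sim_couplingControl)
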